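/- For a Tychonoff space $X$ and a compact $K\subseteq X$, let $\operatorname{Homeo}_K(X)$ be the group of homeomorphisms of $X$ that are the identity on $X\setminus K$, with the compact-open topology, and let $\operatorname{Homeo}_{cpt}(X)=\bigcup_K \operatorname{Homeo}_K(X)$, where $K$ ranges over the compact subsets of $X$. The space $X$ has the Compactly Supported Homeomorphism Property (CSHP) if the following two topologies on $\operatorname{Homeo}_{cpt}(X)$ coincide: (i) the finest topology making all inclusions $\operatorname{Homeo}_K(X)\to\operatorname{Homeo}_{cpt}(X)$ continuous; (ii) the topology induced by $\operatorname{Homeo}(\beta X)$, the homeomorphism group of the Stone–Čech compactification with the compact-open topology, under the map sending a homeomorphism of $X$ to its extension to $\beta X$. Suppose that $\lambda=\alpha+\xi$ (ordinal sum), where $\alpha$ is an ordinal, $\xi>0$ is an infinite limit ordinal, and $\alpha\ge\operatorname{cf}(\xi)$. Then the space $X=\lambda$, that is, the set of ordinals less than $\lambda$ with the order topology, does not have CSHP. -/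

import Mathlib

open Set Topology

namespace CptHomeo

section

variable (X : Type*) [TopologicalSpace X]

/-- The compact-open topology on the group of homeomorphisms of `X`. For compact Hausdorff `X`
this is the usual group topology on `Homeo(X)`. -/
abbrev compactOpen : TopologicalSpace (X ≃ₜ X) :=
  TopologicalSpace.induced (fun h => (h : C(X, X))) ContinuousMap.compactOpen

variable {X}

/-- `Homeo_K(X)`: the homeomorphisms of `X` that are the identity on `X \ K`. -/
def homeoSupp (K : Set X) : Set (X ≃ₜ X) := {h | ∀ x, x ∉ K → h x = x}

variable (X)

/-- `Homeo_cpt(X)`: the union of the `Homeo_K(X)` over all compact `K ⊆ X`. -/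
def homeoCpt : Set (X ≃ₜ X) := {h | ∃ K : Set X, IsCompact K ∧ h ∈ homeoSupp K}

variable {X}

/-- The inclusion `Homeo_K(X) → Homeo_cpt(X)` for a compact set `K`. -/
def incl {K : Set X} (hK : IsCompact K) (h : homeoSupp K) : homeoCpt X :=
  ⟨h.1, K, hK, h.2⟩

/-- The topology of `Homeo_K(X)`: the compact-open topology. -/
abbrev suppTopology (K : Set X) : TopologicalSpace (homeoSupp K) :=
  TopologicalSpace.induced Subtype.val (compactOpen X)

variable (X)

/-- The colimit topology on `Homeo_cpt(X)`: the finest topology for which all the inclusions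
`Homeo_K(X) → Homeo_cpt(X)`, `K` compact, are continuous. (In Mathlib's order on topologies,
finer means smaller, so the supremum of the final topologies is their intersection.) -/
abbrev colimTopology : TopologicalSpace (homeoCpt X) :=
  ⨆ (K : Set X) (hK : IsCompact K), TopologicalSpace.coinduced (incl hK) (suppTopology K)

variable {X}

/-- The continuous extension `βX → βX` of a homeomorphism of `X`. -/
noncomputable def betaMap (h : X ≃ₜ X) : StoneCech X → StoneCech X :=
  stoneCechExtend (continuous_stoneCechUnit.comp h.continuous)

theorem continuous_betaMap (h : X ≃ₜ X) : Continuous (betaMap h) :=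
  continuous_stoneCechExtend _

theorem betaMap_unit (h : X ≃ₜ X) (x : X) : betaMap h (stoneCechUnit x) = stoneCechUnit (h x) :=
  stoneCechExtend_stoneCechUnit _ x

theorem betaMap_betaMap (g h : X ≃ₜ X) (hgh : ∀ x, g (h x) = x) (p : StoneCech X) :
    betaMap g (betaMap h p) = p := by
  have : betaMap g ∘ betaMap h = id := by
    apply stoneCech_hom_ext ((continuous_betaMap g).comp (continuous_betaMap h)) continuous_id
    funext x
    simp [betaMap_unit, hgh]
  exact congrFun this p

/-- The homeomorphism of the Stone–Čech compactification `βX` extending a homeomorphism of `X`. -/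
noncomputable def betaHomeo (h : X ≃ₜ X) : StoneCech X ≃ₜ StoneCech X where
  toFun := betaMap h
  invFun := betaMap h.symm
  left_inv := betaMap_betaMap h.symm h (fun x => h.symm_apply_apply x)
  right_inv := betaMap_betaMap h h.symm (fun x => h.apply_symm_apply x)
  continuous_toFun := continuous_betaMap h
  continuous_invFun := continuous_betaMap h.symm

variable (X)

/-- The topology on `Homeo_cpt(X)` induced by `Homeo(βX)` (with the compact-open topology). -/
noncomputable abbrev betaTopology : TopologicalSpace (homeoCpt X) :=
  TopologicalSpace.induced (fun h => betaHomeo h.1) (compactOpen (StoneCech X))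

/-- The Compactly Supported Homeomorphism Property of a Tychonoff space: the colimit topology on
`Homeo_cpt(X)` coincides with the one induced by `Homeo(βX)`. -/
def HasCSHP [T35Space X] : Prop := colimTopology X = betaTopology X

end

/-- An ordinal `l`, viewed as the set of the ordinals below it, with the subspace topology of
`Ordinal`, carries its order topology. -/
theorem orderTopology_Iio (l : Ordinal) : OrderTopology (Iio l) := inferInstance

end CptHomeo

namespace CptHomeo

open Filter Uniformity

/-! Let κ be the cofinality of `l`, as an initial ordinal. The hypothesis on `α` gives κ < `l`, so
[0, κ] is a compact subset of the space, while isolated points `b i` (i < κ) beyond κ leave every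
compact set. For i < κ, `G i` swaps isolated points `p k` and `q i k` below κ for all k ≥ i. Let `A`
be the set of `h` that, for some i, send `p k` to `q i k` for all k ≥ i and move `b i`.

`A` is closed in the colimit topology: on each Homeo_K only a bounded set of i can occur, and a
single locally constant value `h (p j)` reveals which.

In the β-topology the identity, which is not in `A`, lies in the closure of `A`: `G i` moves only
points between i and κ, so it tends to the identity, and composing it with a swap of two `b`'s close
together in βX gives an element of `A`. -/

/-! ### Swapping isolated points -/

/-- Two isolated points can be swapped by a homeomorphism. -/
theorem exists_homeo_swap {X : Type*} [TopologicalSpace X] [T1Space X] {a c : X}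
    (ha : IsOpen ({a} : Set X)) (hc : IsOpen ({c} : Set X)) :
    ∃ S : X ≃ₜ X, S a = c ∧ S c = a ∧ ∀ x, x ≠ a → x ≠ c → S x = x := by
  classical
  have key : Continuous (Equiv.swap a c) := by
    rw [continuous_iff_continuousAt]
    intro x
    by_cases hxa : x = a
    · subst hxa
      rw [ContinuousAt, (isOpen_singleton_iff_nhds_eq_pure _).1 ha]
      exact (tendsto_pure_nhds _ _)
    by_cases hxc : x = c
    · subst hxc
      rw [ContinuousAt, (isOpen_singleton_iff_nhds_eq_pure _).1 hc]
      exact (tendsto_pure_nhds _ _)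
    · refine continuousAt_id.congr ?_
      filter_upwards [isOpen_ne.mem_nhds hxa, isOpen_ne.mem_nhds hxc] with y hya hyc
      exact (Equiv.swap_apply_of_ne_of_ne hya hyc).symm
  refine ⟨⟨Equiv.swap a c, key, by simpa using key⟩, Equiv.swap_apply_left a c,
    Equiv.swap_apply_right a c, fun x => Equiv.swap_apply_of_ne_of_ne⟩

/-- In a linearly ordered space, isolated points `a k < c k` spanning pairwise disjoint intervals
can be swapped simultaneously by a homeomorphism. -/
theorem exists_homeo_swap_family {X J : Type*} [TopologicalSpace X] [LinearOrder X]
    [OrderTopology X] [LinearOrder J] (a c : J → X)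
    (ha : ∀ k, IsOpen ({a k} : Set X)) (hc : ∀ k, IsOpen ({c k} : Set X))
    (hac : ∀ k, a k < c k) (hca : ∀ k k', k < k' → c k < a k') :
    ∃ G : X ≃ₜ X, (∀ k, G (a k) = c k) ∧ ∀ x, G x ≠ x → ∃ k, x = a k ∨ x = c k := by
  classical
  have uniq : ∀ y k k', a k ≤ y → y ≤ c k → a k' ≤ y → y ≤ c k' → k = k' := by
    intro y k k' h1 h2 h3 h4
    rcases lt_trichotomy k k' with h | h | h
    · exact absurd (h3.trans h2) (hca k k' h).not_ge
    · exact h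
    · exact absurd (h1.trans h4) (hca k' k h).not_ge
  let g : X → X := fun x =>
    if h : ∃ k, x = a k then c h.choose else if h : ∃ k, x = c k then a h.choose else x
  have ga : ∀ k, g (a k) = c k := by
    intro k
    have h : ∃ k', a k = a k' := ⟨k, rfl⟩
    have : h.choose = k := by
      have e := h.choose_spec
      exact uniq (a k) _ _ e.ge (e.le.trans (hac _).le) le_rfl (hac k).le
    simp only [g, dif_pos h, this]
  have gc : ∀ k, g (c k) = a k := by
    intro k
    have h0 : ¬ ∃ k', c k = a k' := by
      rintro ⟨k', e⟩
      have := uniq (c k) k k' (hac k).le le_rfl e.ge (e.le.trans (hac _).le)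
      subst this
      exact (hac k).ne' e
    have h : ∃ k', c k = c k' := ⟨k, rfl⟩
    have : h.choose = k := by
      have e := h.choose_spec
      exact uniq (c k) _ _ ((hac _).le.trans e.ge) e.le (hac k).le le_rfl
    simp only [g, dif_neg h0, dif_pos h, this]
  have gx : ∀ x, (∀ k, x ≠ a k) → (∀ k, x ≠ c k) → g x = x := by
    intro x h1 h2
    have h1' : ¬ ∃ k, x = a k := fun ⟨k, h⟩ => h1 k h
    have h2' : ¬ ∃ k, x = c k := fun ⟨k, h⟩ => h2 k h
    simp only [g, dif_neg h1', dif_neg h2']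
  have cases3 : ∀ x, (∃ k, x = a k) ∨ (∃ k, x = c k) ∨ ((∀ k, x ≠ a k) ∧ ∀ k, x ≠ c k) := by
    intro x
    by_cases h1 : ∃ k, x = a k
    · exact .inl h1
    by_cases h2 : ∃ k, x = c k
    · exact .inr (.inl h2)
    exact .inr (.inr ⟨fun k h => h1 ⟨k, h⟩, fun k h => h2 ⟨k, h⟩⟩)
  have inv : ∀ x, g (g x) = x := by
    intro x
    rcases cases3 x with ⟨k, rfl⟩ | ⟨k, rfl⟩ | ⟨h1, h2⟩
    · rw [ga, gc]
    · rw [gc, ga]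
    · rw [gx x h1 h2, gx x h1 h2]
  have cont : Continuous g := by
    rw [continuous_iff_continuousAt]
    intro x
    rcases cases3 x with ⟨k, rfl⟩ | ⟨k, rfl⟩ | ⟨h1, h2⟩
    · rw [ContinuousAt, (isOpen_singleton_iff_nhds_eq_pure _).1 (ha k)]
      exact tendsto_pure_nhds _ _
    · rw [ContinuousAt, (isOpen_singleton_iff_nhds_eq_pure _).1 (hc k)]
      exact tendsto_pure_nhds _ _
    · rw [ContinuousAt, gx x h1 h2, tendsto_order]
      refine ⟨fun y hy => ?_, fun y hy => ?_⟩
      · have : ∀ᶠ z in 𝓝 x, ∀ k, a k ≤ y → y ≤ c k → z ≠ c k := by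
          by_cases hk : ∃ k, a k ≤ y ∧ y ≤ c k
          · obtain ⟨k, hk1, hk2⟩ := hk
            filter_upwards [isOpen_ne.mem_nhds (h2 k)] with z hz k' h3 h4
            rwa [← uniq y k k' hk1 hk2 h3 h4]
          · exact .of_forall fun z k h3 h4 => (hk ⟨k, h3, h4⟩).elim
        filter_upwards [this, lt_mem_nhds hy] with z hz hyz
        rcases cases3 z with ⟨k, rfl⟩ | ⟨k, rfl⟩ | ⟨h3, h4⟩
        · rw [ga]; exact hyz.trans (hac k)
        · rw [gc]
          by_contra! h
          exact hz k h hyz.le rfl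
        · rwa [gx z h3 h4]
      · have : ∀ᶠ z in 𝓝 x, ∀ k, a k ≤ y → y ≤ c k → z ≠ a k := by
          by_cases hk : ∃ k, a k ≤ y ∧ y ≤ c k
          · obtain ⟨k, hk1, hk2⟩ := hk
            filter_upwards [isOpen_ne.mem_nhds (h1 k)] with z hz k' h3 h4
            rwa [← uniq y k k' hk1 hk2 h3 h4]
          · exact .of_forall fun z k h3 h4 => (hk ⟨k, h3, h4⟩).elim
        filter_upwards [this, gt_mem_nhds hy] with z hz hyz
        rcases cases3 z with ⟨k, rfl⟩ | ⟨k, rfl⟩ | ⟨h3, h4⟩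
        · rw [ga]
          by_contra! h
          exact hz k hyz.le h rfl
        · rw [gc]; exact (hac k).trans hyz
        · rwa [gx z h3 h4]
  refine ⟨⟨⟨g, g, inv, inv⟩, cont, cont⟩, ga, fun x hx => ?_⟩
  rcases cases3 x with ⟨k, rfl⟩ | ⟨k, rfl⟩ | ⟨h1, h2⟩
  · exact ⟨k, .inl rfl⟩
  · exact ⟨k, .inr rfl⟩
  · exact absurd (gx x h1 h2) hx

/-! ### The two topologies and the criterion -/

/-- Evaluation at a point is continuous for the compact-open topology on homeomorphisms. -/
theorem continuous_eval_suppTopology {X : Type*} [TopologicalSpace X] (K : Set X) (x : X) :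
    @Continuous _ _ (suppTopology K) _ (fun h : homeoSupp K => h.1 x) := by
  let := compactOpen X
  let := suppTopology K
  have h1 : Continuous (fun h : X ≃ₜ X => (h : C(X, X))) := continuous_induced_dom
  have h2 : Continuous (Subtype.val : homeoSupp K → (X ≃ₜ X)) := continuous_induced_dom
  exact (continuous_eval_const (F := C(X, X)) x).comp (h1.comp h2)

/-- Every neighborhood of the identity in the topology induced by `Homeo(βX)` contains all
compactly supported homeomorphisms that are uniformly close to the identity. -/
theorem exists_entourage_of_isOpen_betaTopology {X : Type*} [TopologicalSpace X]
    {U : Set (homeoCpt X)} (hU : IsOpen[betaTopology X] U) (e : homeoCpt X) (he : e ∈ U)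
    (he1 : ∀ x, e.1 x = x) :
    ∃ V ∈ @uniformity (StoneCech X) uniformSpaceOfCompactR1, ∀ h : homeoCpt X,
      (∀ x, (stoneCechUnit x, stoneCechUnit (h.1 x)) ∈ V) → h ∈ U := by
  let : UniformSpace (StoneCech X) := uniformSpaceOfCompactR1
  obtain ⟨O', hO', rfl⟩ := hU
  obtain ⟨O, hO, rfl⟩ := hO'
  have heO : ((betaHomeo e.1 : StoneCech X ≃ₜ StoneCech X) : C(StoneCech X, StoneCech X)) ∈ O := he
  have hb : ∀ p, betaMap e.1 p = p := by
    have : betaMap e.1 = id := by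
      apply stoneCech_hom_ext (continuous_betaMap _) continuous_id
      funext x
      simp [betaMap_unit, he1]
    exact congrFun this
  obtain ⟨V, ⟨hV, hVc⟩, hVO⟩ := (nhds_basis_uniformity'
    (uniformity_hasBasis_closed (α := StoneCech X)).compactConvergenceUniformity_of_compact).mem_iff.1
      (hO.mem_nhds heO)
  refine ⟨V, hV, fun h hh => hVO ?_⟩
  intro p
  change (betaMap e.1 p, betaMap h.1 p) ∈ V
  rw [hb]
  -- `V` was chosen closed, so the bound passes from the dense image of X to βX.
  refine denseRange_stoneCechUnit.induction_on p ?_ ?_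
  · exact hVc.preimage (continuous_id.prodMk (continuous_betaMap h.1))
  · intro x
    rw [betaMap_unit]
    exact hh x

/-- A criterion for the failure of the CSHP: the isolated points `b i` leave every compact set,
while the homeomorphisms `G i`, supported in a fixed compact set, converge to the identity and
are told apart by their values at the isolated points `p k`. -/
theorem not_hasCSHP_of_family {X J : Type*} [TopologicalSpace X] [T35Space X] [LinearOrder J]
    [Nonempty J] (p b : J → X) (q : J → J → X)
    (hp : ∀ k, IsOpen ({p k} : Set X)) (hb : ∀ i, IsOpen ({b i} : Set X))
    (hq : ∀ j i i', q i j = q i' j → i = i')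
    (hbK : ∀ K : Set X, IsCompact K → ∃ j, ∀ i, j ≤ i → b i ∉ K)
    (K₀ : Set X) (hK₀ : IsCompact K₀) (hpK : ∀ k, p k ∈ K₀) (hbK₀ : ∀ i, b i ∉ K₀)
    (G : J → X ≃ₜ X) (hG : ∀ i, G i ∈ homeoSupp K₀) (hGp : ∀ i k, i ≤ k → G i (p k) = q i k)
    (z : X) (hGz : ∀ O ∈ 𝓝 z, ∃ j, ∀ i, j ≤ i → ∀ x, G i x ≠ x → x ∈ O) :
    ¬ HasCSHP X := by
  intro hX
  let A : Set (homeoCpt X) :=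
    {h | ∃ i, (∀ k, i ≤ k → h.1 (p k) = q i k) ∧ h.1 (b i) ≠ b i}
  have hA : IsOpen[colimTopology X] Aᶜ := by
    rw [colimTopology, isOpen_iSup_iff]
    intro K
    rw [isOpen_iSup_iff]
    intro hK
    rw [isOpen_coinduced]
    let := suppTopology K
    have ev : ∀ x, Continuous (fun h : homeoSupp K => h.1 x) := continuous_eval_suppTopology K
    obtain ⟨j, hj⟩ := hbK K hK
    rw [isOpen_iff_mem_nhds]
    intro h hh
    have hmem : ∀ h' : homeoSupp K, incl hK h' ∈ A ↔
        ∃ i, (∀ k, i ≤ k → h'.1 (p k) = q i k) ∧ h'.1 (b i) ≠ b i := fun _ => Iff.rfl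
    rw [mem_preimage, mem_compl_iff, hmem] at hh
    have hfix : ∀ i, ∀ h' : homeoSupp K, h'.1 (b i) ≠ b i → i ≤ j := by
      intro i h' hi
      by_contra! hji
      exact hi (h'.2 _ (hj i hji.le))
    -- The image of the isolated point `p j` is isolated, so the value there is locally constant.
    -- Any witness i is at most j, so this value is `q i j` and determines i.
    have hN : ∀ᶠ h' in 𝓝 h, h'.1 (p j) = h.1 (p j) := by
      have : IsOpen ({h.1 (p j)} : Set X) := by
        simpa using h.1.isOpenMap _ (hp j)
      exact (ev (p j)).continuousAt.eventually (this.mem_nhds rfl)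
    by_cases hi : ∃ i, h.1 (p j) = q i j
    · obtain ⟨i, hi⟩ := hi
      have hN2 : ∀ᶠ h' in 𝓝 h, ¬ ((∀ k, i ≤ k → h'.1 (p k) = q i k) ∧ h'.1 (b i) ≠ b i) := by
        by_cases h1 : h.1 (b i) = b i
        · filter_upwards [(ev (b i)).continuousAt.eventually ((hb i).mem_nhds h1)] with h' hh'
          exact fun H => H.2 hh'
        · have h2 : ¬ ∀ k, i ≤ k → h.1 (p k) = q i k := fun H => hh ⟨i, H, h1⟩
          push Not at h2
          obtain ⟨k, hk, hne⟩ := h2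
          filter_upwards [(ev (p k)).continuousAt.eventually (isOpen_ne.mem_nhds hne)] with h' hh'
          exact fun H => hh' (H.1 k hk)
      filter_upwards [hN, hN2] with h' h1 h2
      rw [mem_preimage, mem_compl_iff, hmem]
      rintro ⟨i', h3, h4⟩
      obtain rfl : i' = i := hq j _ _ (by rw [← h3 j (hfix i' h' h4), h1, hi])
      exact h2 ⟨h3, h4⟩
    · filter_upwards [hN] with h' h1
      rw [mem_preimage, mem_compl_iff, hmem]
      rintro ⟨i', h3, h4⟩
      exact hi ⟨i', by rw [← h1, h3 j (hfix i' h' h4)]⟩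
  rw [show colimTopology X = betaTopology X from hX] at hA
  let e : homeoCpt X := ⟨Homeomorph.refl X, ∅, isCompact_empty, fun _ _ => rfl⟩
  obtain ⟨V, hV, hVA⟩ := exists_entourage_of_isOpen_betaTopology hA e
    (by rintro ⟨i, -, h⟩; exact h rfl) (fun _ => rfl)
  let : UniformSpace (StoneCech X) := uniformSpaceOfCompactR1
  obtain ⟨W, hW, hWs, hWV⟩ := comp_symm_mem_uniformity_sets hV
  have close : ∀ y s t : StoneCech X, (s, y) ∈ W → (t, y) ∈ W → (s, t) ∈ V := fun y s t hs ht =>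
    hWV ⟨y, hs, hWs.symm _ _ ht⟩
  have hWn : ∀ y : StoneCech X, {s | (s, y) ∈ W} ∈ 𝓝 y := fun y => mem_nhds_right y hW
  obtain ⟨j, hj⟩ := hGz (stoneCechUnit ⁻¹' {s | (s, stoneCechUnit z) ∈ W})
    (continuous_stoneCechUnit.continuousAt (hWn _))
  -- By compactness of βX, arbitrarily late `b i` come close to one point y; two of them can be
  -- swapped at small uniform cost.
  obtain ⟨y, hy⟩ := exists_clusterPt_of_compactSpace
    (Filter.map (fun i => (stoneCechUnit (b i) : StoneCech X)) atTop)
  have hfreq : ∀ j, ∃ i, j ≤ i ∧ ((stoneCechUnit (b i) : StoneCech X), y) ∈ W := by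
    intro j
    obtain ⟨i, hi, hji⟩ := ((MapClusterPt.frequently hy (hWn y)).and_eventually
      (eventually_ge_atTop j)).exists
    exact ⟨i, hji, hi⟩
  obtain ⟨i, hji, hi⟩ := hfreq j
  obtain ⟨j', hj'⟩ := hbK {b i} isCompact_singleton
  obtain ⟨i', hji', hi'⟩ := hfreq j'
  have hne : b i' ≠ b i := hj' i' hji'
  obtain ⟨S, hS1, hS2, hS⟩ := exists_homeo_swap (hb i) (hb i')
  have hSK : ∀ x ∈ K₀, S x = x := fun x hx =>
    hS x (fun h => hbK₀ i (h ▸ hx)) (fun h => hbK₀ i' (h ▸ hx))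
  have hGS : ∀ x, G i (S x) = x ∨ (x ∈ K₀ ∧ G i (S x) = G i x) ∨ x = b i ∧ G i (S x) = b i' ∨
      x = b i' ∧ G i (S x) = b i := by
    intro x
    by_cases hx : x ∈ K₀
    · exact .inr (.inl ⟨hx, by rw [hSK x hx]⟩)
    by_cases h1 : x = b i
    · subst h1
      exact .inr (.inr (.inl ⟨rfl, by rw [hS1, hG i _ (hbK₀ i')]⟩))
    by_cases h2 : x = b i'
    · subst h2
      exact .inr (.inr (.inr ⟨rfl, by rw [hS2, hG i _ (hbK₀ i)]⟩))
    · exact .inl (by rw [hS x h1 h2, hG i x hx])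
  let h : homeoCpt X := ⟨S.trans (G i), K₀ ∪ {b i, b i'},
    hK₀.union (Set.toFinite _).isCompact, by
      intro x hx
      simp only [mem_union, mem_insert_iff, mem_singleton_iff, not_or] at hx
      change G i (S x) = x
      rw [hS x hx.2.1 hx.2.2, hG i x hx.1]⟩
  have hhA : h ∈ A := by
    refine ⟨i, fun k hk => ?_, ?_⟩
    · change G i (S (p k)) = q i k
      rw [hSK _ (hpK k), hGp i k hk]
    · change G i (S (b i)) ≠ b i
      rwa [hS1, hG i _ (hbK₀ i')]
  refine hVA h (fun x => ?_) hhA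
  change (stoneCechUnit x, stoneCechUnit (G i (S x))) ∈ V
  rcases hGS x with h1 | ⟨-, h1⟩ | ⟨rfl, h1⟩ | ⟨rfl, h1⟩
  · rw [h1]; exact refl_mem_uniformity hV
  · rw [h1]
    by_cases hx : G i x = x
    · rw [hx]; exact refl_mem_uniformity hV
    -- By injectivity `G i x` is moved too, so both points are near z.
    · exact close _ _ _ (hj i hji x hx) (hj i hji (G i x) fun h => hx ((G i).injective h))
  · rw [h1]; exact close y _ _ hi hi'
  · rw [h1]; exact close y _ _ hi' hi

-- Ordinals and the construction

universe u

theorem isOpen_singleton_Iio {l : Ordinal.{u}} (x : Iio l) (hx : ¬ Order.IsSuccLimit x.1) :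
    IsOpen ({x} : Set (Iio l)) := by
  have h := (SuccOrder.isOpen_singleton_iff.2 hx).preimage (continuous_subtype_val (p := (· ∈ Iio l)))
  convert h using 1
  ext y
  simp [Subtype.ext_iff]

theorem isCompact_Iic_Iio {l : Ordinal.{u}} (x : Iio l) : IsCompact (Iic x) := by
  rw [IsEmbedding.subtypeVal.isCompact_iff]
  convert (isCompact_Icc : IsCompact (Icc 0 x.1)) using 1
  ext y
  constructor
  · rintro ⟨y, hy, rfl⟩
    exact ⟨zero_le, hy⟩
  · rintro ⟨-, hy⟩
    exact ⟨⟨y, hy.trans_lt x.2⟩, hy, rfl⟩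

/-- Every ordinal has a strictly increasing cofinal family indexed by its cofinality. -/
theorem exists_strictMono_cofinal (l : Ordinal.{u}) :
    ∃ f : Iio l.cof.ord → Iio l, StrictMono f ∧ ∀ x, ∃ j, x ≤ f j := by
  obtain ⟨s, hs, hs'⟩ := Ordinal.exists_ord_cof_eq (Iio l)
  have : Ordinal.type (α := s) (· < ·) = Ordinal.type (α := Iio l.cof.ord) (· < ·) := by
    rw [hs', Ordinal.cof_Iio, ← Ordinal.lift_cof, ← Cardinal.lift_ord, Ordinal.type_lt_Iio]
  obtain ⟨φ⟩ := Ordinal.type_eq.1 this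
  let ψ := OrderIso.ofRelIsoLT φ
  refine ⟨fun j => (ψ.symm j).1, fun i j h => ψ.symm.strictMono h, fun x => ?_⟩
  obtain ⟨y, hy, hxy⟩ := hs x
  exact ⟨ψ ⟨y, hy⟩, by simpa using hxy⟩

/-- The squares of successor ordinals leave gaps of growing length. -/
theorem sq_succ_add_lt {k k' : Ordinal.{u}} (h : k < k') :
    (k + 1) * (k + 1) + (k + 1) < (k' + 1) * (k' + 1) := by
  have h1 : k + 1 < k' + 1 := by simpa using h
  calc (k + 1) * (k + 1) + (k + 1) = (k + 1) * (k + 1 + 1) := by rw [mul_add_one (k + 1) (k + 1)]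
    _ ≤ (k + 1) * (k' + 1) := by
      gcongr
      exact Order.add_one_le_of_lt h
    _ = (k + 1) * k' + (k + 1) := mul_add_one _ _
    _ ≤ (k' + 1) * k' + (k + 1) := by gcongr
    _ < (k' + 1) * k' + (k' + 1) := by gcongr
    _ = (k' + 1) * (k' + 1) := (mul_add_one _ _).symm

end CptHomeo

theorem mainTheorem6 (l α ξ : Ordinal) (hl : l = α + ξ) (hξ : Order.IsSuccLimit ξ)
    (hα : ξ.cof.ord ≤ α) : ¬ CptHomeo.HasCSHP (Set.Iio l) := by
  have hcof : l.cof = ξ.cof := by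
    rw [hl]; exact Ordinal.cof_map_of_isNormal (Ordinal.isNormal_add_right α) hξ
  have hlim : Order.IsSuccLimit l := by
    rw [hl]; exact (Ordinal.isNormal_add_right α).map_isSuccLimit hξ
  have hκ0 : Cardinal.aleph0 ≤ l.cof := Ordinal.aleph0_le_cof_iff.2 (Ordinal.one_lt_cof_iff.2 hlim)
  have hκl : l.cof.ord < l := by
    rw [hcof, hl]
    exact hα.trans_lt (lt_add_of_pos_right α hξ.bot_lt)
  obtain ⟨f, hf, hfc⟩ := CptHomeo.exists_strictMono_cofinal l
  generalize hκ : l.cof.ord = κ at *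
  have hadd : ∀ a < κ, ∀ b < κ, a + b < κ := fun a ha b hb =>
    hκ ▸ Ordinal.isPrincipal_add_ord hκ0 (hκ ▸ ha) (hκ ▸ hb)
  have hmul : ∀ a < κ, ∀ b < κ, a * b < κ := fun a ha b hb =>
    hκ ▸ Ordinal.isPrincipal_mul_ord hκ0 (hκ ▸ ha) (hκ ▸ hb)
  have hone : ∀ a < κ, a + 1 < κ := fun a ha =>
    (hκ ▸ Cardinal.isSuccLimit_ord hκ0 : Order.IsSuccLimit κ).add_one_lt ha
  have hpos : 0 < κ := (hκ ▸ Cardinal.isSuccLimit_ord hκ0 : Order.IsSuccLimit κ).bot_lt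
  have hpκ : ∀ k < κ, (k + 1) * (k + 1) < κ := fun k hk => hmul _ (hone k hk) _ (hone k hk)
  have hkp : ∀ k : Ordinal, k < (k + 1) * (k + 1) := fun k =>
    (lt_add_one k).trans_le (Ordinal.le_mul_left _ (by simp))
  have hqκ : ∀ i < κ, ∀ k < κ, (k + 1) * (k + 1) + (i + 1) < κ := fun i hi k hk =>
    hadd _ (hpκ k hk) _ (hone i hi)
  -- An infinite initial ordinal is closed under sums and products, so these points stay below κ;
  -- for i ≤ k, `q i k` precedes the next square.
  let p : Iio κ → Iio l := fun k => ⟨(k.1 + 1) * (k.1 + 1), (hpκ k.1 k.2).trans hκl⟩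
  let q : Iio κ → Iio κ → Iio l := fun i k =>
    ⟨(k.1 + 1) * (k.1 + 1) + (i.1 + 1), (hqκ i.1 i.2 k.1 k.2).trans hκl⟩
  -- The maximum puts `b i` beyond both κ and the cofinal family; the successor makes it isolated.
  let b : Iio κ → Iio l := fun i => ⟨max (f i).1 κ + 1, hlim.add_one_lt (max_lt (f i).2 hκl)⟩
  have hp : ∀ k, IsOpen ({p k} : Set (Iio l)) := fun k => CptHomeo.isOpen_singleton_Iio _ (by
    change ¬ Order.IsSuccLimit ((k.1 + 1) * (k.1 + 1))
    rw [mul_add_one, ← add_assoc]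
    exact Order.not_isSuccLimit_add_one _)
  have hq : ∀ i k, IsOpen ({q i k} : Set (Iio l)) := fun i k =>
    CptHomeo.isOpen_singleton_Iio _ (by
      change ¬ Order.IsSuccLimit ((k.1 + 1) * (k.1 + 1) + (i.1 + 1))
      rw [← add_assoc]
      exact Order.not_isSuccLimit_add_one _)
  have hb : ∀ i, IsOpen ({b i} : Set (Iio l)) := fun i =>
    CptHomeo.isOpen_singleton_Iio _ (Order.not_isSuccLimit_add_one (max (f i).1 κ))
  have hG : ∀ i : Iio κ, ∃ G : Iio l ≃ₜ Iio l, (∀ k : {k // i ≤ k}, G (p k) = q i k) ∧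
      ∀ x, G x ≠ x → ∃ k : {k // i ≤ k}, x = p k ∨ x = q i k := fun i =>
    CptHomeo.exists_homeo_swap_family (fun k : {k // i ≤ k} => p k) (fun k => q i k)
      (fun k => hp k) (fun k => hq i k)
      (fun k => Subtype.mk_lt_mk.2 (lt_add_of_pos_right _ (by simp)))
      (fun k k' h => Subtype.mk_lt_mk.2 (lt_of_le_of_lt
        (add_le_add_right (add_le_add_left (show i.1 ≤ k.1.1 from k.2) 1) _) (CptHomeo.sq_succ_add_lt (k := k.1.1) (k' := k'.1.1) h)))
  choose G hGp hGx using hG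
  have hmoved : ∀ i x, G i x ≠ x → i.1 < x.1 ∧ x.1 < κ := by
    intro i x hx
    obtain ⟨k, hk⟩ := hGx i x hx
    have hik : i.1 < (k.1.1 + 1) * (k.1.1 + 1) :=
      lt_of_le_of_lt (show i.1 ≤ k.1.1 from k.2) (hkp _)
    rcases hk with rfl | rfl
    · exact ⟨hik, hpκ _ k.1.2⟩
    · exact ⟨hik.trans_le (le_add_of_nonneg_right zero_le), hqκ _ i.2 _ k.1.2⟩
  have : Nonempty (Iio κ) := ⟨⟨0, hpos⟩⟩
  refine CptHomeo.not_hasCSHP_of_family p b q hp hb ?_ ?_ (Iic ⟨κ, hκl⟩) (CptHomeo.isCompact_Iic_Iio _)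
    (fun k => (hpκ k.1 k.2).le) ?_ G ?_ (fun i k hik => hGp i ⟨k, hik⟩) ⟨κ, hκl⟩ ?_
  · intro j i i' h
    have h := Subtype.ext_iff.1 h
    simpa [q, Subtype.ext_iff] using h
  · intro K hK
    have : Nonempty (Iio l) := ⟨⟨κ, hκl⟩⟩
    obtain ⟨u, hu⟩ := hK.bddAbove
    obtain ⟨j, hj⟩ := hfc u
    refine ⟨j, fun i hi hb => ?_⟩
    have h1 : (b i).1 ≤ (f i).1 := (hu hb).trans (hj.trans (hf.monotone hi))
    exact absurd ((le_max_left _ _).trans_lt (lt_add_one (max (f i).1 κ))) h1.not_gt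
  · intro i h
    exact absurd ((le_max_right _ _).trans_lt (lt_add_one (max (f i).1 κ))) (not_lt.2 h)
  · intro i x hx
    by_contra h
    exact hx (hmoved i x h).2.le
  · intro O hO
    obtain ⟨c, hc, hcO⟩ := exists_Ioc_subset_of_mem_nhds hO ⟨⟨0, hpos.trans hκl⟩, hpos⟩
    -- A neighbourhood of κ contains some (c, κ], and c < κ itself serves as the index.
    refine ⟨⟨c.1, hc⟩, fun i hi x hx => hcO ⟨?_, (hmoved i x hx).2.le⟩⟩
    exact Subtype.coe_lt_coe.1 (lt_of_le_of_lt (show c.1 ≤ i.1 from hi) (hmoved i x hx).1)
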